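/- **Lemma 5 (Change-of-measure).** All logarithms, and $\exp\{\cdot\}$, are to base $2$. Let $W=\{W(y|x)\}$ be a discrete memoryless channel with finite alphabets $\mathcal X,\mathcal Y$ that is output symmetric (that is, $\mathcal Y$ can be partitioned so that in the block of transition probabilities of each part the rows are permutations of each other and the columns are permutations of each other) and has dispersion $\nu(W)=\min_{P:\,I(P,W)=C(W)}\mathrm E\big[\mathrm{Var}[i(X;Y)|X]\big]>0$, where $C(W)=\max_P I(P,W)$ and, for $(X,Y)$ distributed as $P(x)W(y|x)$, $i(x;y)=\log\frac{W(y|x)}{\sum_{x'}P(x')W(y|x')}$. Let $0<t<\frac13$, let $T\ge 2$ be an integer, and let $(S_n)$ be a sequence of integers with $S_n=\omega(n^t)$. Put $\zeta=\frac12(\frac13-t)$, $R_n=C(W)-n^{-t}$, $$S_n^*=\min\big\{S_n,\lfloor\exp\{n^{(1-3(t+\zeta))/4}\}\rfloor\big\},\qquad \delta_n=\frac{(T-1)R_n}{S_n^*+T-1},$$ and let $(\delta_n')$ be any sequence of positive numbers with $\delta'_n=\Theta\big(\frac{\delta_n}{-\log\delta_n}\big)$. Let $V_n^*$ be an optimal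 auxiliary channel for the Haroutunian exponent at rate $R_n-2\delta_n$, that is, $$V_n^*\in\mathop{\mathrm{argmin}}_{V:\,C(V)\le R_n-2\delta_n}\ \max_{P\in\mathcal P(\mathcal X)}D(V\|W|P),\qquad D(V\|W|P)=\sum_xP(x)\sum_yV(y|x)\log\frac{V(y|x)}{W(y|x)}$$ (which may be $+\infty$; $V_n^*$ exists for all sufficiently large $n$). Then there is a sequence $\eta_n>0$ with $\eta_n=o(n^{-2t})$ such that, for every $n\ge1$ for which $V_n^*$ exists, every $x^{Tn}\in\mathcal X^{Tn}$ and every $A\subseteq\mathcal Y^{Tn}$ with $(V_n^*)^{Tn}(A|x^{Tn})\ge\frac{\delta_n'}2$, $$W^{Tn}(A|x^{Tn})\ \ge\ \frac{\delta'_n}{4}\exp\Big\{-Tn\Big(D(V_n^*\|W|P_{x^{Tn}})+\eta_n\Big)\Big\},$$ where $V^l(\cdot|x^l)$ and $W^l(\cdot|x^l)$ denote the product laws $\prod_iV(\cdot|x_i)$ and $\prod_iW(\cdot|x_i)$, and $P_{x^{Tn}}$ is the type (empirical distribution) of $x^{Tn}$. -/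

import Mathlib

open Filter Asymptotics
open scoped Topology ENNReal

namespace StreamingDMC

noncomputable section

variable {X Y : Type*} [Fintype X] [Fintype Y]

/-- `W x y = W(y|x)` is a discrete memoryless channel from `X` to `Y`: every row `W x` is a
probability distribution on `Y`. -/
def IsChannel (W : X → Y → ℝ) : Prop := ∀ x, W x ∈ stdSimplex ℝ Y

/-- The output distribution `PW(y) = ∑ₓ P(x) W(y|x)`. -/
def outputDist (P : X → ℝ) (W : X → Y → ℝ) (y : Y) : ℝ := ∑ x, P x * W x y

/-- The information density `i(x;y) = log₂ (W(y|x) / PW(y))`. -/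
def infoDensity (P : X → ℝ) (W : X → Y → ℝ) (x : X) (y : Y) : ℝ :=
  Real.logb 2 (W x y / outputDist P W y)

/-- The mutual information `I(P,W) = E[i(X;Y)]`, in bits. -/
def mutualInfo (P : X → ℝ) (W : X → Y → ℝ) : ℝ :=
  ∑ x, ∑ y, P x * W x y * infoDensity P W x y

/-- The conditional information variance `V(P,W) = E[Var[i(X;Y) | X]]`. -/
def condInfoVar (P : X → ℝ) (W : X → Y → ℝ) : ℝ :=
  ∑ x, P x * ∑ y, W x y * (infoDensity P W x y - ∑ y', W x y' * infoDensity P W x y') ^ 2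

/-- The capacity `C(W) = max_P I(P,W)`. -/
def capacity (W : X → Y → ℝ) : ℝ :=
  sSup ((fun P => mutualInfo P W) '' stdSimplex ℝ X)

/-- The set `Π(W)` of capacity-achieving input distributions. -/
def capacityAchieving (W : X → Y → ℝ) : Set (X → ℝ) :=
  {P | P ∈ stdSimplex ℝ X ∧ mutualInfo P W = capacity W}

/-- The channel dispersion `ν(W) = min_{P ∈ Π(W)} V(P,W)`. -/
def dispersion (W : X → Y → ℝ) : ℝ :=
  sInf ((fun P => condInfoVar P W) '' capacityAchieving W)

/-- Output symmetry in the sense of Gallager: `Y` is partitioned (into the classes of `r`) so that,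
in the block of transition probabilities of each class, the rows are permutations of each other and
the columns are permutations of each other. -/
def OutputSymmetric (W : X → Y → ℝ) : Prop :=
  ∃ r : Setoid Y, ∀ B ∈ r.classes,
    (∀ x x' : X, ∃ σ : Equiv.Perm B, ∀ y : B, W x' (σ y) = W x y) ∧
    (∀ y ∈ B, ∀ y' ∈ B, ∃ τ : Equiv.Perm X, ∀ x, W (τ x) y' = W x y)

open scoped Classical in
/-- The divergence `D(p‖q) = ∑_y p(y) log₂ (p(y)/q(y))` of distributions on `Y`, in bits, equal to
`+∞` if `p` is not absolutely continuous with respect to `q`. -/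
def divergence (p q : Y → ℝ) : EReal :=
  if ∀ y, q y = 0 → p y = 0 then ((∑ y, p y * Real.logb 2 (p y / q y) : ℝ) : EReal) else ⊤

/-- The conditional divergence `D(V‖W|P) = ∑ₓ P(x) D(V(·|x)‖W(·|x))` (with `0 · ∞ = 0`). -/
def condDivergence (V W : X → Y → ℝ) (P : X → ℝ) : EReal :=
  ∑ x, ((P x : ℝ) : EReal) * divergence (V x) (W x)

/-- `V` attains the minimum of the Haroutunian exponent
`E⁺(R) = min_{V : C(V) ≤ R} max_P D(V‖W|P)` of the channel `W` at rate `R`. -/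
def IsHaroutunianOptimal (W : X → Y → ℝ) (R : ℝ) (V : X → Y → ℝ) : Prop :=
  V ∈ {V' : X → Y → ℝ | IsChannel V' ∧ capacity V' ≤ R} ∧
  IsMinOn (fun V' => ⨆ P ∈ stdSimplex ℝ X, condDivergence V' W P)
    {V' : X → Y → ℝ | IsChannel V' ∧ capacity V' ≤ R} V

/-- The type (empirical distribution) of the vector `x` of length `l`. -/
def empiricalType [DecidableEq X] {l : ℕ} (x : Fin l → X) (a : X) : ℝ :=
  ((Finset.univ.filter fun i => x i = a).card : ℝ) / (l : ℝ)

/-- The probability `W^l(A|x)` that `l` uses of `W` with input `x` have output in `A ⊆ Y^l`. -/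
def channelProb (W : X → Y → ℝ) {l : ℕ} (x : Fin l → X) (A : Finset (Fin l → Y)) : ℝ :=
  ∑ y ∈ A, ∏ i, W (x i) (y i)

/-- The base-two exponential `2^a` of an extended real `a`, with `2^(-∞) = 0`. -/
def exp2 (a : EReal) : ℝ≥0∞ := EReal.exp (a * ((Real.log 2 : ℝ) : EReal))

/-- The rate `R_n = C(W) - n^{-t}`. -/
def rate (W : X → Y → ℝ) (t : ℝ) (n : ℕ) : ℝ := capacity W - (n : ℝ) ^ (-t)

/-- `ζ = (1/3 - t)/2`. -/
def zeta (t : ℝ) : ℝ := (1 / 3 - t) / 2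

/-- The number `S_n^* = min {S_n, ⌊2^(n^((1 - 3(t+ζ))/4))⌋}` of messages. -/
def numMessages (t : ℝ) (S : ℕ → ℕ) (n : ℕ) : ℕ :=
  min (S n) ⌊(2 : ℝ) ^ ((n : ℝ) ^ ((1 - 3 * (t + zeta t)) / 4))⌋₊

/-- `δ_n = (T - 1) R_n / (S_n^* + T - 1)`: the gap from `R_n` to the effective rate
`S_n^* R_n / (S_n^* + T - 1)`. -/
def rateGap (W : X → Y → ℝ) (t : ℝ) (T : ℕ) (S : ℕ → ℕ) (n : ℕ) : ℝ :=
  ((T : ℝ) - 1) * rate W t n / ((numMessages t S n : ℝ) + (T : ℝ) - 1)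

end

end StreamingDMC

/-!
# Change of measure for Haroutunian-optimal auxiliary channels

The point is that `V_n` is so close to `W` that the log-likelihood ratio `log (V_n / W)` is
uniformly of size `O(n ^ (-t))`, and not merely bounded.

For an output symmetric channel the output distribution `q` of the uniform input is at divergence
`C(W)` from every row, and the information density relative to `q` has the same variance under
every row (`exists_equidistant_output`); positive dispersion makes that variance positive.
Reweighting each row by `1 - lam * (i(x;y) - C(W))` then lowers the divergence to `q`, hence the
capacity, linearly in `lam`, while the divergence from the row of `W` is only quadratic
(`tilted_row`). So the Haroutunian exponent at rate `C(W) - g` is `O(g ^ 2)`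
(`relEntropy_le_of_isHaroutunianOptimal`). Relative entropy dominates the squared Hellinger
distance, so an optimal `V` satisfies `|log (V / W)| = O(g)` wherever `W` is positive
(`abs_log_div_le`). Here `g = n ^ (-t) + 2 δ_n = O(n ^ (-t))`, since `S_n^*` is at least `n ^ t`
eventually.

A Chernoff bound for the sum of the centred log-likelihood ratios (`channelProb_le`) shows that,
with slack `n ^ (-2 t - a)` per letter, the likelihood ratio exceeds its typical size with
probability at most `exp (-const * n ^ (1 - 2 t - 3 a))`. For `a = (1 - 3 t) / 8` this is below
`δ'_n / 4`, because the cap on `S_n^*` keeps `δ'_n` above a multiple of `2 ^ (-2 n ^ a)`. On the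
rest of `A` the change of measure costs at most the claimed factor. The finitely many `n` for
which these estimates are not yet in force are covered by a constant penalty
(`ofReal_mul_exp2_le_of_small`).
-/

namespace StreamingDMC

section Channels

variable {X Y : Type*} [Fintype X] [Fintype Y]

/-! ### Relative entropy on a finite alphabet -/

/-- The relative entropy `∑ p log (p / q)` in nats, as a real number. It is meaningful only when
`p` is absolutely continuous with respect to `q`; otherwise the terms with `q y = 0 < p y` are
silently dropped because `p y / 0 = 0`. -/
noncomputable def relEntropy (p q : Y → ℝ) : ℝ := ∑ y, p y * Real.log (p y / q y)

lemma sq_sqrt_sub_sqrt_le {a b : ℝ} (ha : 0 ≤ a) (hb : 0 ≤ b) (hab : b = 0 → a = 0) :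
    (√a - √b) ^ 2 ≤ a * Real.log (a / b) - a + b := by
  rcases ha.eq_or_lt with rfl | ha'
  · simp [Real.sq_sqrt hb]
  have hb' : 0 < b := hb.lt_of_ne fun h => ha'.ne' (hab h.symm)
  have hsa : 0 < √a := Real.sqrt_pos.2 ha'
  have hsb : 0 < √b := Real.sqrt_pos.2 hb'
  have h1 : Real.log (√b / √a) ≤ √b / √a - 1 := Real.log_le_sub_one_of_pos (by positivity)
  have h2 : Real.log (a / b) = -2 * Real.log (√b / √a) := by
    rw [Real.log_div ha'.ne' hb'.ne', Real.log_div hsb.ne' hsa.ne', Real.log_sqrt ha,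
      Real.log_sqrt hb]
    ring
  have h3 : a * (√b / √a) = √a * √b := by
    have : a = √a * √a := (Real.mul_self_sqrt ha).symm
    field_simp
    rw [Real.sq_sqrt ha]
  have h4 : a * Real.log (√b / √a) ≤ √a * √b - a := by
    nlinarith [mul_le_mul_of_nonneg_left h1 ha]
  rw [h2]
  nlinarith [Real.sq_sqrt ha, Real.sq_sqrt hb]

/-- Relative entropy dominates the squared Hellinger distance. -/
lemma sum_sq_sqrt_sub_sqrt_le_relEntropy {p q : Y → ℝ} (hp : p ∈ stdSimplex ℝ Y)
    (hq : q ∈ stdSimplex ℝ Y) (hpq : ∀ y, q y = 0 → p y = 0) :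
    ∑ y, (√(p y) - √(q y)) ^ 2 ≤ relEntropy p q := by
  calc ∑ y, (√(p y) - √(q y)) ^ 2
      ≤ ∑ y, (p y * Real.log (p y / q y) - p y + q y) :=
        Finset.sum_le_sum fun y _ => sq_sqrt_sub_sqrt_le (hp.1 y) (hq.1 y) (hpq y)
    _ = relEntropy p q := by
        rw [Finset.sum_add_distrib, Finset.sum_sub_distrib, hp.2, hq.2, relEntropy]
        ring

lemma relEntropy_nonneg {p q : Y → ℝ} (hp : p ∈ stdSimplex ℝ Y)
    (hq : q ∈ stdSimplex ℝ Y) (hpq : ∀ y, q y = 0 → p y = 0) : 0 ≤ relEntropy p q :=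
  (Finset.sum_nonneg fun _ _ => sq_nonneg _).trans
    (sum_sq_sqrt_sub_sqrt_le_relEntropy hp hq hpq)

lemma divergence_of_ac {p q : Y → ℝ} (hpq : ∀ y, q y = 0 → p y = 0) :
    divergence p q = ((relEntropy p q / Real.log 2 : ℝ) : EReal) := by
  rw [divergence, if_pos hpq, relEntropy, Finset.sum_div]
  simp only [Real.logb, mul_div_assoc]

lemma divergence_nonneg {p q : Y → ℝ} (hp : p ∈ stdSimplex ℝ Y)
    (hq : q ∈ stdSimplex ℝ Y) : 0 ≤ divergence p q := by
  by_cases hpq : ∀ y, q y = 0 → p y = 0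
  · rw [divergence_of_ac hpq]
    exact EReal.coe_nonneg.2 (div_nonneg (relEntropy_nonneg hp hq hpq) (Real.log_nonneg one_le_two))
  · rw [divergence, if_neg hpq]
    exact le_top

lemma condDivergence_nonneg {V W : X → Y → ℝ} (hV : IsChannel V) (hW : IsChannel W) {P : X → ℝ}
    (hP : ∀ x, 0 ≤ P x) : 0 ≤ condDivergence V W P :=
  Finset.sum_nonneg fun x _ =>
    mul_nonneg (EReal.coe_nonneg.2 (hP x)) (divergence_nonneg (hV x) (hW x))

lemma ereal_coe_sum {ι : Type*} (s : Finset ι) (f : ι → ℝ) :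
    ((∑ i ∈ s, f i : ℝ) : EReal) = ∑ i ∈ s, (f i : EReal) := by
  classical
  induction s using Finset.induction_on with
  | empty => simp
  | insert a s ha ih => rw [Finset.sum_insert ha, Finset.sum_insert ha, EReal.coe_add, ih]

lemma condDivergence_of_ac {V W : X → Y → ℝ} (h : ∀ x y, W x y = 0 → V x y = 0) (P : X → ℝ) :
    condDivergence V W P = ((∑ x, P x * (relEntropy (V x) (W x) / Real.log 2) : ℝ) : EReal) := by
  rw [condDivergence, ereal_coe_sum]
  exact Finset.sum_congr rfl fun x _ => by rw [divergence_of_ac (h x), EReal.coe_mul]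

lemma condDivergence_single [DecidableEq X] (V W : X → Y → ℝ) (x : X) :
    condDivergence V W (Pi.single x 1) = divergence (V x) (W x) := by
  rw [condDivergence, Finset.sum_eq_single x]
  · simp
  · intro b _ hb
    simp [Pi.single_eq_of_ne hb]
  · simp

/-! ### Upper bounds on capacity -/

/-- The mutual information is at most the average divergence from any output distribution `q`. -/
lemma mutualInfo_le {V : X → Y → ℝ} (hV : IsChannel V) {P : X → ℝ} (hP : P ∈ stdSimplex ℝ X)
    {q : Y → ℝ} (hq : q ∈ stdSimplex ℝ Y) (hVq : ∀ x y, q y = 0 → V x y = 0) :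
    mutualInfo P V ≤ (∑ x, P x * relEntropy (V x) q) / Real.log 2 := by
  have hL : 0 < Real.log 2 := Real.log_pos one_lt_two
  rw [le_div_iff₀ hL]
  have h1 : mutualInfo P V * Real.log 2 =
      ∑ y, ∑ x, P x * (V x y * Real.log (V x y / outputDist P V y)) := by
    rw [mutualInfo, Finset.sum_comm, Finset.sum_mul]
    refine Finset.sum_congr rfl fun y _ => ?_
    rw [Finset.sum_mul]
    refine Finset.sum_congr rfl fun x _ => ?_
    rw [infoDensity, Real.logb]
    field_simp
  have h2 : ∑ x, P x * relEntropy (V x) q =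
      ∑ y, ∑ x, P x * (V x y * Real.log (V x y / q y)) := by
    rw [Finset.sum_comm]
    exact Finset.sum_congr rfl fun x _ => by rw [relEntropy, Finset.mul_sum]
  have hout : ∑ y, outputDist P V y = 1 := by
    simp only [outputDist]
    rw [Finset.sum_comm]
    simp only [← Finset.mul_sum, (hV _).2, mul_one, hP.2]
  rw [h1, h2, ← sub_nonpos, ← Finset.sum_sub_distrib]
  have key : ∀ y, (∑ x, P x * (V x y * Real.log (V x y / outputDist P V y))) -
      ∑ x, P x * (V x y * Real.log (V x y / q y)) ≤ q y - outputDist P V y := by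
    intro y
    have ho : 0 ≤ outputDist P V y :=
      Finset.sum_nonneg fun x _ => mul_nonneg (hP.1 x) ((hV x).1 y)
    have h0 : ∀ x, P x * V x y = 0 ∨ (0 < P x * V x y ∧ 0 < V x y ∧ 0 < q y
        ∧ 0 < outputDist P V y) := by
      intro x
      rcases (mul_nonneg (hP.1 x) ((hV x).1 y)).eq_or_lt with h | h
      · exact Or.inl h.symm
      · have hv : 0 < V x y := ((hV x).1 y).lt_of_ne fun h' => by simp [← h'] at h
        exact Or.inr ⟨h, hv, (hq.1 y).lt_of_ne fun h' => hv.ne' (hVq x y h'.symm),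
          h.trans_le (Finset.single_le_sum (f := fun x => P x * V x y)
            (fun x _ => mul_nonneg (hP.1 x) ((hV x).1 y)) (Finset.mem_univ x))⟩
    rw [← Finset.sum_sub_distrib]
    have h3 : ∀ x ∈ Finset.univ, P x * (V x y * Real.log (V x y / outputDist P V y)) -
        P x * (V x y * Real.log (V x y / q y)) ≤
        P x * V x y * (q y / outputDist P V y) - P x * V x y := by
      intro x _
      rcases h0 x with h | ⟨h, hv, hqy, hoy⟩
      · simp only [← mul_assoc, h]; simp
      · have := Real.log_le_sub_one_of_pos (div_pos hqy hoy)
        rw [Real.log_div hqy.ne' hoy.ne'] at this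
        rw [Real.log_div hv.ne' hoy.ne', Real.log_div hv.ne' hqy.ne']
        nlinarith [mul_le_mul_of_nonneg_left this h.le]
    refine (Finset.sum_le_sum h3).trans ?_
    rw [Finset.sum_sub_distrib, ← Finset.sum_mul]
    change outputDist P V y * _ - outputDist P V y ≤ _
    rcases ho.eq_or_lt with h | h
    · rw [← h]; simpa using hq.1 y
    · rw [mul_div_cancel₀ _ h.ne']
  refine (Finset.sum_le_sum fun y _ => key y).trans ?_
  rw [Finset.sum_sub_distrib, hq.2, hout, sub_self]

lemma mutualInfo_le_of_forall {V : X → Y → ℝ} (hV : IsChannel V) {P : X → ℝ}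
    (hP : P ∈ stdSimplex ℝ X) {q : Y → ℝ} (hq : q ∈ stdSimplex ℝ Y)
    (hVq : ∀ x y, q y = 0 → V x y = 0) {c : ℝ} (hc : ∀ x, relEntropy (V x) q ≤ c) :
    mutualInfo P V ≤ c / Real.log 2 := by
  refine (mutualInfo_le hV hP hq hVq).trans ?_
  have hL : 0 < Real.log 2 := Real.log_pos one_lt_two
  gcongr
  calc ∑ x, P x * relEntropy (V x) q ≤ ∑ x, P x * c :=
        Finset.sum_le_sum fun x _ => mul_le_mul_of_nonneg_left (hc x) (hP.1 x)
    _ = c := by rw [← Finset.sum_mul, hP.2, one_mul]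

lemma capacity_le [Nonempty X] {V : X → Y → ℝ} (hV : IsChannel V)
    {q : Y → ℝ} (hq : q ∈ stdSimplex ℝ Y)
    (hVq : ∀ x y, q y = 0 → V x y = 0) {c : ℝ} (hc : ∀ x, relEntropy (V x) q ≤ c) :
    capacity V ≤ c / Real.log 2 := by
  classical
  refine csSup_le (Set.Nonempty.image _ ⟨_, single_mem_stdSimplex ℝ (Classical.arbitrary X)⟩) ?_
  rintro _ ⟨P, hP, rfl⟩
  exact mutualInfo_le_of_forall hV hP hq hVq hc

/-! ### Output symmetric channels -/

/-- Sums over the output alphabet of a function of the transition probability and of a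
class-constant weight do not depend on the input letter. -/
lemma sum_eq_of_row_perm {X : Type*} {W : X → Y → ℝ} {r : Setoid Y} {q : Y → ℝ}
    (hrow : ∀ B ∈ r.classes, ∀ x x' : X, ∃ σ : Equiv.Perm B, ∀ y : B, W x' (σ y) = W x y)
    (hq : ∀ y y', r y y' → q y = q y') (F : ℝ → ℝ → ℝ) (x x' : X) :
    ∑ y, F (W x y) (q y) = ∑ y, F (W x' y) (q y) := by
  classical
  rw [← Fintype.sum_fiberwise (fun y => (Quotient.mk r y)) (fun y => F (W x y) (q y)),
    ← Fintype.sum_fiberwise (fun y => (Quotient.mk r y)) (fun y => F (W x' y) (q y))]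
  refine Finset.sum_congr rfl fun c _ => ?_
  induction c using Quotient.inductionOn with
  | h y₀ =>
    have hB : {y | Quotient.mk r y = Quotient.mk r y₀} = {y | r y y₀} := by
      ext y; exact Quotient.eq
    obtain ⟨σ, hσ⟩ := hrow {y | Quotient.mk r y = Quotient.mk r y₀}
      (hB ▸ Setoid.mem_classes r y₀) x x'
    refine Fintype.sum_equiv σ _ _ fun y => ?_
    have h1 : q (σ y) = q y :=
      hq _ _ (Quotient.exact ((σ y).2.trans y.2.symm))
    rw [h1]
    exact congrArg (F · _) (hσ y).symm

lemma condInfoVar_nonneg {W : X → Y → ℝ} (hW : IsChannel W) {P : X → ℝ}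
    (hP : P ∈ stdSimplex ℝ X) : 0 ≤ condInfoVar P W :=
  Finset.sum_nonneg fun x _ => mul_nonneg (hP.1 x) <|
    Finset.sum_nonneg fun y _ => mul_nonneg ((hW x).1 y) (sq_nonneg _)

lemma nonempty_of_dispersion_pos {W : X → Y → ℝ} (hν : 0 < dispersion W) : Nonempty X := by
  by_contra h
  rw [not_nonempty_iff] at h
  have : capacityAchieving W = ∅ := by
    ext P
    simp only [capacityAchieving, Set.mem_ofPred_eq, Set.mem_empty_iff_false, iff_false]
    rintro ⟨hP, -⟩
    simpa using hP.2
  simp [dispersion, this] at hν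

/-- For an output symmetric channel of positive dispersion, the output distribution `q` of the
uniform input is equidistant (at the capacity, here in nats) from all rows of the channel, and the
information density relative to `q` has the same positive variance under every row. -/
lemma exists_equidistant_output {W : X → Y → ℝ} (hW : IsChannel W) (hsymm : OutputSymmetric W)
    (hν : 0 < dispersion W) :
    ∃ q ∈ stdSimplex ℝ Y, ∃ v > 0, (∀ x y, q y = 0 → W x y = 0) ∧
      (∀ x, relEntropy (W x) q = capacity W * Real.log 2) ∧
      ∀ x, ∑ y, W x y * (Real.log (W x y / q y) - capacity W * Real.log 2) ^ 2 = v := by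
  have hne : Nonempty X := nonempty_of_dispersion_pos hν
  have hL : 0 < Real.log 2 := Real.log_pos one_lt_two
  obtain ⟨r, hr⟩ := hsymm
  let U : X → ℝ := fun _ => 1 / (Fintype.card X : ℝ)
  have hcard : (0 : ℝ) < Fintype.card X := by exact_mod_cast Fintype.card_pos
  have hU : U ∈ stdSimplex ℝ X := by
    refine ⟨fun x => by positivity, ?_⟩
    simp [U, hcard.ne']
  set q : Y → ℝ := outputDist U W with hqdef
  have hq : q ∈ stdSimplex ℝ Y := by
    refine ⟨fun y => Finset.sum_nonneg fun x _ => mul_nonneg (hU.1 x) ((hW x).1 y), ?_⟩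
    simp only [hqdef, outputDist]
    rw [Finset.sum_comm]
    simp only [← Finset.mul_sum, (hW _).2, mul_one, hU.2]
  have hac : ∀ x y, q y = 0 → W x y = 0 := by
    intro x y h
    have := (Finset.sum_eq_zero_iff_of_nonneg
      (fun x _ => mul_nonneg (hU.1 x) ((hW x).1 y))).1 h x (Finset.mem_univ x)
    rcases mul_eq_zero.1 this with h | h
    · exact absurd h (by positivity)
    · exact h
  have hqr : ∀ y y', r y y' → q y = q y' := by
    intro y y' h
    obtain ⟨τ, hτ⟩ := (hr _ (Setoid.mem_classes r y')).2 y h y' (Setoid.refl y')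
    exact Fintype.sum_equiv τ _ _ fun x => by rw [hτ]
  have hrow := fun B hB => (hr B hB).1
  obtain ⟨x₀⟩ := hne
  have hD : ∀ x, relEntropy (W x) q = relEntropy (W x₀) q := fun x =>
    sum_eq_of_row_perm hrow hqr (fun a b => a * Real.log (a / b)) x x₀
  have hIU : mutualInfo U W = relEntropy (W x₀) q / Real.log 2 := by
    have : ∀ x, ∑ y, U x * W x y * infoDensity U W x y =
        U x * (relEntropy (W x₀) q / Real.log 2) := by
      intro x
      rw [← hD x, relEntropy, Finset.sum_div, Finset.mul_sum]
      refine Finset.sum_congr rfl fun y _ => ?_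
      rw [infoDensity, Real.logb]
      ring
    rw [mutualInfo, Finset.sum_congr rfl fun x _ => this x, ← Finset.sum_mul, hU.2, one_mul]
  have hbdd : ∀ P ∈ stdSimplex ℝ X, mutualInfo P W ≤ relEntropy (W x₀) q / Real.log 2 :=
    fun P hP => mutualInfo_le_of_forall hW hP hq hac fun x => (hD x).le
  have hC : capacity W = relEntropy (W x₀) q / Real.log 2 := by
    have : Nonempty X := ⟨x₀⟩
    refine le_antisymm (capacity_le hW hq hac fun x => (hD x).le) ?_
    rw [← hIU]
    refine le_csSup ⟨relEntropy (W x₀) q / Real.log 2, ?_⟩ ⟨U, hU, rfl⟩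
    rintro _ ⟨P, hP, rfl⟩
    exact hbdd P hP
  have hC' : capacity W * Real.log 2 = relEntropy (W x₀) q := by
    rw [hC]; field_simp
  have hv : ∀ x, ∑ y, W x y * (Real.log (W x y / q y) - capacity W * Real.log 2) ^ 2 =
      ∑ y, W x₀ y * (Real.log (W x₀ y / q y) - capacity W * Real.log 2) ^ 2 := fun x =>
    sum_eq_of_row_perm hrow hqr
      (fun a b => a * (Real.log (a / b) - capacity W * Real.log 2) ^ 2) x x₀
  refine ⟨q, hq, _, ?_, hac, fun x => by rw [hC', hD], hv⟩
  have hVU : 0 < condInfoVar U W :=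
    hν.trans_le (csInf_le ⟨0, by
      rintro _ ⟨P, hP, rfl⟩
      exact condInfoVar_nonneg hW hP.1⟩ ⟨U, ⟨hU, hIU.trans hC.symm⟩, rfl⟩)
  have hmean : ∀ x, ∑ y, W x y * infoDensity U W x y = capacity W := by
    intro x
    rw [hC, ← hD x, relEntropy, Finset.sum_div]
    refine Finset.sum_congr rfl fun y _ => ?_
    rw [infoDensity, Real.logb]
    ring
  have hvar : condInfoVar U W = (∑ y, W x₀ y *
      (Real.log (W x₀ y / q y) - capacity W * Real.log 2) ^ 2) / Real.log 2 ^ 2 := by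
    have : ∀ x, U x * ∑ y, W x y * (infoDensity U W x y - capacity W) ^ 2 =
        U x * ((∑ y, W x₀ y *
      (Real.log (W x₀ y / q y) - capacity W * Real.log 2) ^ 2) / Real.log 2 ^ 2) := by
      intro x
      rw [← hv x, Finset.sum_div]
      congr 1
      refine Finset.sum_congr rfl fun y _ => ?_
      rw [infoDensity, Real.logb]
      field_simp
      rfl
    simp only [condInfoVar, hmean]
    rw [Finset.sum_congr rfl fun x _ => this x, ← Finset.sum_mul, hU.2, one_mul]
  rw [hvar] at hVU
  by_contra h
  exact absurd hVU (not_lt.2 (div_nonpos_of_nonpos_of_nonneg (not_lt.1 h) (sq_nonneg _)))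

/-! ### Tilting a channel against its information density -/

/-- Reweighting a distribution `p` by `1 - lam * z`, where `z` is the centred log-likelihood ratio
of `p` to `q` and has variance `v`, costs relative entropy of second order in `lam`, but lowers
the relative entropy to `q` at first order. -/
lemma tilted_row {p q : Y → ℝ} (hp : p ∈ stdSimplex ℝ Y) (hpq : ∀ y, q y = 0 → p y = 0)
    {c v H lam : ℝ} (hc : relEntropy p q = c)
    (hv : ∑ y, p y * (Real.log (p y / q y) - c) ^ 2 = v)
    (hH : ∀ y, |Real.log (p y / q y) - c| ≤ H) (hH1 : 1 ≤ H) (hlam0 : 0 ≤ lam)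
    (hlam : lam * H ≤ 1 / 2) :
    (fun y => p y * (1 - lam * (Real.log (p y / q y) - c))) ∈ stdSimplex ℝ Y ∧
    relEntropy (fun y => p y * (1 - lam * (Real.log (p y / q y) - c))) p ≤ lam ^ 2 * v ∧
    relEntropy (fun y => p y * (1 - lam * (Real.log (p y / q y) - c))) q ≤ c - lam * v / 2 := by
  set z : Y → ℝ := fun y => Real.log (p y / q y) - c with hz
  have hu0 : ∀ y, 0 < 1 - lam * z y := fun y => by
    have h1 : lam * z y ≤ lam * H :=
      mul_le_mul_of_nonneg_left ((le_abs_self _).trans (hH y)) hlam0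
    linarith
  have hpz : ∑ y, p y * z y = 0 := by
    simp only [hz, mul_sub, Finset.sum_sub_distrib, ← Finset.sum_mul, hp.2, one_mul]
    rw [← hc, relEntropy, sub_self]
  have hv0 : 0 ≤ v := hv ▸ Finset.sum_nonneg fun y _ => mul_nonneg (hp.1 y) (sq_nonneg _)
  have hv' : ∑ y, p y * z y ^ 2 = v := hv
  have hup : relEntropy (fun y => p y * (1 - lam * z y)) p ≤ lam ^ 2 * v := by
    calc relEntropy (fun y => p y * (1 - lam * z y)) p
        ≤ ∑ y, (lam ^ 2 * (p y * z y ^ 2) - lam * (p y * z y)) := by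
          refine Finset.sum_le_sum fun y _ => ?_
          rcases (hp.1 y).eq_or_lt with h | h
          · simp [← h]
          · rw [mul_div_cancel_left₀ _ h.ne']
            have := Real.log_le_sub_one_of_pos (hu0 y)
            nlinarith [mul_le_mul_of_nonneg_left this (mul_pos h (hu0 y)).le]
      _ = lam ^ 2 * v := by
          rw [Finset.sum_sub_distrib, ← Finset.mul_sum, ← Finset.mul_sum, hpz, hv']
          ring
  have huq : relEntropy (fun y => p y * (1 - lam * z y)) q =
      relEntropy (fun y => p y * (1 - lam * z y)) p + (c - lam * v) := by
    have h1 : ∑ y, p y * (1 - lam * z y) * (z y + c) = c - lam * v := by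
      have : ∀ y, p y * (1 - lam * z y) * (z y + c) =
          p y * z y + c * p y - lam * (p y * z y ^ 2) - lam * c * (p y * z y) := fun y => by ring
      simp only [this, Finset.sum_sub_distrib, Finset.sum_add_distrib, ← Finset.mul_sum, hpz, hv',
        hp.2]
      ring
    rw [← h1, relEntropy, relEntropy, ← Finset.sum_add_distrib]
    refine Finset.sum_congr rfl fun y _ => ?_
    rcases (hp.1 y).eq_or_lt with h | h
    · simp [← h]
    · have hq : q y ≠ 0 := fun h' => h.ne' (hpq y h')
      rw [show z y + c = Real.log (p y / q y) from sub_add_cancel _ _, ← mul_add,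
        mul_div_cancel_left₀ _ h.ne', mul_comm (p y), mul_div_assoc,
        Real.log_mul (hu0 y).ne' (div_ne_zero h.ne' hq)]
  refine ⟨⟨fun y => mul_nonneg (hp.1 y) (hu0 y).le, ?_⟩, hup, ?_⟩
  · have : ∀ y, p y * (1 - lam * z y) = p y - lam * (p y * z y) := fun y => by ring
    change ∑ y, p y * (1 - lam * z y) = 1
    simp only [this, Finset.sum_sub_distrib, ← Finset.mul_sum, hpz, hp.2]
    ring
  · have hl : lam ≤ 1 / 2 := (le_mul_of_one_le_right hlam0 hH1).trans hlam
    rw [huq]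
    nlinarith [mul_nonneg (mul_nonneg hlam0 hv0) (sub_nonneg.2 hl)]

/-- The capacity of an output symmetric channel of positive dispersion can be lowered by any small
amount `g` at the price of a relative entropy `O(g ^ 2)` from every row. -/
lemma exists_channel_capacity_le {W : X → Y → ℝ} (hW : IsChannel W) (hsymm : OutputSymmetric W)
    (hν : 0 < dispersion W) :
    0 < capacity W ∧ ∃ g₀ > 0, ∃ K > 0, ∀ g, 0 ≤ g → g ≤ g₀ → ∃ V : X → Y → ℝ, IsChannel V ∧
      capacity V ≤ capacity W - g ∧ (∀ x y, W x y = 0 → V x y = 0) ∧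
      ∀ x, relEntropy (V x) (W x) ≤ K * g ^ 2 := by
  have hne : Nonempty X := nonempty_of_dispersion_pos hν
  have hL : 0 < Real.log 2 := Real.log_pos one_lt_two
  obtain ⟨q, hq, v, hv0, hac, hc, hv⟩ := exists_equidistant_output hW hsymm hν
  set c := capacity W * Real.log 2 with hcdef
  set H : ℝ := 1 + ∑ x, ∑ y, |Real.log (W x y / q y) - c| with hHdef
  have hH : ∀ x y, |Real.log (W x y / q y) - c| ≤ H := fun x y => by
    have h1 : |Real.log (W x y / q y) - c| ≤ ∑ y, |Real.log (W x y / q y) - c| :=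
      Finset.single_le_sum (f := fun y => |Real.log (W x y / q y) - c|)
        (fun _ _ => abs_nonneg _) (Finset.mem_univ y)
    have h2 : ∑ y, |Real.log (W x y / q y) - c| ≤ ∑ x, ∑ y, |Real.log (W x y / q y) - c| :=
      Finset.single_le_sum (f := fun x => ∑ y, |Real.log (W x y / q y) - c|)
        (fun _ _ => Finset.sum_nonneg fun _ _ => abs_nonneg _) (Finset.mem_univ x)
    linarith
  have hH1 : 1 ≤ H := le_add_of_nonneg_right
    (Finset.sum_nonneg fun _ _ => Finset.sum_nonneg fun _ _ => abs_nonneg _)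
  have hH0 : 0 < H := one_pos.trans_le hH1
  have row := fun (lam : ℝ) (h0 : 0 ≤ lam) (h1 : lam * H ≤ 1 / 2) (x : X) =>
    tilted_row (hW x) (hac x) (hc x) (hv x) (hH x) hH1 h0 h1
  constructor
  -- The tilted row is still at nonnegative divergence from `q`, so `0 ≤ c - lam * v / 2`.
  · obtain ⟨x⟩ := hne
    have hlam : 0 < 1 / (2 * H) := by positivity
    obtain ⟨h1, -, h3⟩ := row (1 / (2 * H)) hlam.le (by field_simp; rfl) x
    have h4 := (relEntropy_nonneg h1 hq fun y hy => by simp [hac x y hy]).trans h3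
    have : 0 < c := by nlinarith [mul_pos hlam hv0]
    exact pos_of_mul_pos_left this hL.le
  · refine ⟨v / (4 * Real.log 2 * H), by positivity, 4 * Real.log 2 ^ 2 / v, by positivity,
      fun g hg0 hg => ?_⟩
    -- The tilt `lam = 2 * log 2 * g / v` makes the capacity drop `lam * v / 2` nats, i.e. `g` bits.
    have h0 : 0 ≤ 2 * Real.log 2 * g / v := by positivity
    have h1 : 2 * Real.log 2 * g / v * H ≤ 1 / 2 := by
      rw [le_div_iff₀ (by positivity)] at hg
      rw [div_mul_eq_mul_div, div_le_iff₀ hv0]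
      linarith
    refine ⟨fun x y => W x y * (1 - 2 * Real.log 2 * g / v * (Real.log (W x y / q y) - c)),
      fun x => (row _ h0 h1 x).1, ?_, fun x y h => by simp [h], fun x => ?_⟩
    · refine (capacity_le (fun x => (row _ h0 h1 x).1) hq (fun x y h => by simp [hac x y h])
        fun x => (row _ h0 h1 x).2.2).trans (le_of_eq ?_)
      rw [hcdef]
      field_simp
    · refine (row _ h0 h1 x).2.1.trans (le_of_eq ?_)
      field_simp
      ring

/-- Every channel attaining the Haroutunian exponent at a rate `g` below capacity has rows at
relative entropy `O(g ^ 2)` from those of the given channel. -/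
lemma relEntropy_le_of_isHaroutunianOptimal {W : X → Y → ℝ} (hW : IsChannel W)
    (hsymm : OutputSymmetric W) (hν : 0 < dispersion W) :
    ∃ g₀ > 0, ∃ K > 0, ∀ g, 0 ≤ g → g ≤ g₀ → ∀ V : X → Y → ℝ,
      IsHaroutunianOptimal W (capacity W - g) V →
      (∀ x y, W x y = 0 → V x y = 0) ∧ ∀ x, relEntropy (V x) (W x) ≤ K * g ^ 2 := by
  classical
  have hL : 0 < Real.log 2 := Real.log_pos one_lt_two
  obtain ⟨-, g₀, hg₀, K, hK, h⟩ := exists_channel_capacity_le hW hsymm hν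
  refine ⟨g₀, hg₀, K, hK, fun g hg0 hg V hV => ?_⟩
  obtain ⟨V', hV', hcap, hac, hD⟩ := h g hg0 hg
  have hsup : ⨆ P ∈ stdSimplex ℝ X, condDivergence V' W P ≤
      ((K * g ^ 2 / Real.log 2 : ℝ) : EReal) := by
    refine iSup₂_le fun P hP => ?_
    rw [condDivergence_of_ac hac, EReal.coe_le_coe_iff]
    calc ∑ x, P x * (relEntropy (V' x) (W x) / Real.log 2)
        ≤ ∑ x, P x * (K * g ^ 2 / Real.log 2) := by
          refine Finset.sum_le_sum fun x _ => mul_le_mul_of_nonneg_left ?_ (hP.1 x)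
          gcongr
          exact hD x
      _ = K * g ^ 2 / Real.log 2 := by rw [← Finset.sum_mul, hP.2, one_mul]
  have hdiv : ∀ x, divergence (V x) (W x) ≤ ((K * g ^ 2 / Real.log 2 : ℝ) : EReal) := fun x => by
    rw [← condDivergence_single V W x]
    exact ((le_iSup₂ (f := fun P (_ : P ∈ stdSimplex ℝ X) => condDivergence V W P)
      _ (single_mem_stdSimplex ℝ x)).trans (hV.2 ⟨hV', hcap⟩)).trans hsup
  have hacV : ∀ x y, W x y = 0 → V x y = 0 := fun x => by
    by_contra hx
    have := hdiv x
    rw [divergence, if_neg hx, top_le_iff] at this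
    exact EReal.coe_ne_top _ this
  refine ⟨hacV, fun x => ?_⟩
  have := hdiv x
  rwa [divergence_of_ac (hacV x), EReal.coe_le_coe_iff, div_le_div_iff_of_pos_right hL] at this

/-! ### Log-likelihood ratios of nearby channels -/

lemma exists_pos_le_of_ne_zero {W : X → Y → ℝ} (hW : IsChannel W) :
    ∃ w > 0, w ≤ 1 ∧ ∀ x y, W x y ≠ 0 → w ≤ W x y := by
  classical
  rcases isEmpty_or_nonempty (X × Y) with h | h
  · exact ⟨1, one_pos, le_rfl, fun x y => (h.false (x, y)).elim⟩
  · obtain ⟨m, hm⟩ := Finite.exists_min fun a : X × Y => if W a.1 a.2 = 0 then 1 else W a.1 a.2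
    refine ⟨min 1 (if W m.1 m.2 = 0 then 1 else W m.1 m.2), ?_, min_le_left _ _, fun x y h => ?_⟩
    · refine lt_min one_pos ?_
      split_ifs with h
      · exact one_pos
      · exact ((hW m.1).1 m.2).lt_of_ne (Ne.symm h)
    · refine (min_le_right _ _).trans ((hm (x, y)).trans ?_)
      simp [h]

/-- A small relative entropy bounds the log-likelihood ratio pointwise, because it dominates the
squared Hellinger distance. -/
lemma abs_log_div_le {p q : Y → ℝ} (hp : p ∈ stdSimplex ℝ Y) (hq : q ∈ stdSimplex ℝ Y)
    (hpq : ∀ y, q y = 0 → p y = 0) {w s : ℝ} (hw : ∀ y, q y ≠ 0 → w ≤ q y)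
    (hs0 : 0 ≤ s) (hs : s ≤ 1 / 2) (hD : relEntropy p q ≤ s ^ 2 * w) {y : Y} (hy : q y ≠ 0) :
    0 < p y ∧ |Real.log (p y / q y)| ≤ 4 * s := by
  have hqy : 0 < q y := (hq.1 y).lt_of_ne (Ne.symm hy)
  have hsq : 0 < √(q y) := Real.sqrt_pos.2 hqy
  have h1 : (√(p y) - √(q y)) ^ 2 ≤ (s * √(q y)) ^ 2 := by
    calc (√(p y) - √(q y)) ^ 2 ≤ ∑ y, (√(p y) - √(q y)) ^ 2 :=
          Finset.single_le_sum (f := fun y => (√(p y) - √(q y)) ^ 2)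
            (fun _ _ => sq_nonneg _) (Finset.mem_univ y)
      _ ≤ s ^ 2 * w := (sum_sq_sqrt_sub_sqrt_le_relEntropy hp hq hpq).trans hD
      _ ≤ s ^ 2 * q y := mul_le_mul_of_nonneg_left (hw y hy) (sq_nonneg s)
      _ = (s * √(q y)) ^ 2 := by rw [mul_pow, Real.sq_sqrt hqy.le]
  have h2 := abs_le.1 (abs_le_of_sq_le_sq h1 (by positivity))
  have hr1 : √(p y) / √(q y) ≤ 1 + s := by rw [div_le_iff₀ hsq]; linarith
  have hr2 : 1 - s ≤ √(p y) / √(q y) := by rw [le_div_iff₀ hsq]; linarith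
  have hr0 : 0 < √(p y) / √(q y) := by linarith
  have hpy : 0 < p y := by
    refine (hp.1 y).lt_of_ne fun h => ?_
    simp [← h] at hr0
  have hlog : Real.log (p y / q y) = 2 * Real.log (√(p y) / √(q y)) := by
    rw [Real.log_div hpy.ne' hy, Real.log_div (Real.sqrt_pos.2 hpy).ne' hsq.ne',
      Real.log_sqrt hpy.le, Real.log_sqrt hqy.le]
    ring
  refine ⟨hpy, ?_⟩
  have hu := Real.log_le_sub_one_of_pos hr0
  have hl := Real.one_sub_inv_le_log_of_pos hr0
  have hinv : (√(p y) / √(q y))⁻¹ ≤ 1 + 2 * s := by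
    rw [inv_le_iff_one_le_mul₀ hr0]
    nlinarith
  rw [hlog, abs_le]
  constructor <;> linarith

/-! ### Change of measure -/

lemma sum_mul_exp_le {p f : Y → ℝ} (hp : p ∈ stdSimplex ℝ Y) {B : ℝ} (hB : B ≤ 1)
    (hf : ∀ y, p y ≠ 0 → |f y| ≤ B) (hpf : ∑ y, p y * f y = 0) :
    ∑ y, p y * Real.exp (f y) ≤ Real.exp (B ^ 2) := by
  calc ∑ y, p y * Real.exp (f y) ≤ ∑ y, (p y + p y * f y + p y * B ^ 2) := by
        refine Finset.sum_le_sum fun y _ => ?_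
        rcases eq_or_ne (p y) 0 with h | h
        · simp [h]
        · have h1 := (abs_le.1 (Real.abs_exp_sub_one_sub_id_le ((hf y h).trans hB))).2
          have h2 : f y ^ 2 ≤ B ^ 2 := sq_le_sq' (abs_le.1 (hf y h)).1 (abs_le.1 (hf y h)).2
          nlinarith [mul_le_mul_of_nonneg_left (h1.trans h2) (hp.1 y)]
    _ = B ^ 2 + 1 := by
        rw [Finset.sum_add_distrib, Finset.sum_add_distrib, hpf, ← Finset.sum_mul, hp.2]
        ring
    _ ≤ Real.exp (B ^ 2) := Real.add_one_le_exp _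

/-- Change of measure with a Chernoff bound: outside an event of exponentially small
`V`-probability, the likelihood ratio of `V` to `W` is at most its typical size, increased by the
slack `a` per letter. -/
lemma channelProb_le {X : Type*} {V W : X → Y → ℝ} (hV : IsChannel V) (hW : IsChannel W)
    (hac : ∀ x y, W x y = 0 → V x y = 0) {M θ a : ℝ} (hθ : 0 ≤ θ) (hθM : θ * M ≤ 1)
    (hM : ∀ x y, V x y ≠ 0 → |Real.log (V x y / W x y) - relEntropy (V x) (W x)| ≤ M)
    {l : ℕ} (x : Fin l → X) (A : Finset (Fin l → Y)) :
    channelProb V x A ≤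
      channelProb W x A * Real.exp (∑ i, relEntropy (V (x i)) (W (x i)) + l * a) +
      Real.exp (l * ((θ * M) ^ 2 - θ * a)) := by
  classical
  set d : X → ℝ := fun x => relEntropy (V x) (W x) with hd
  set f : X → Y → ℝ := fun x y => θ * (Real.log (V x y / W x y) - d x) with hf
  have hpt : ∀ y : Fin l → Y, ∏ i, V (x i) (y i) ≤
      (∏ i, W (x i) (y i)) * Real.exp (∑ i, d (x i) + l * a) +
      (∏ i, V (x i) (y i) * Real.exp (f (x i) (y i))) * Real.exp (-(l * (θ * a))) := by
    intro y
    have hVn : 0 ≤ ∏ i, V (x i) (y i) := Finset.prod_nonneg fun i _ => (hV (x i)).1 _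
    have hWn : 0 ≤ ∏ i, W (x i) (y i) := Finset.prod_nonneg fun i _ => (hW (x i)).1 _
    rw [Finset.prod_mul_distrib, ← Real.exp_sum, mul_assoc, ← Real.exp_add]
    by_cases h0 : ∏ i, V (x i) (y i) = 0
    · rw [h0]; positivity
    have hVi : ∀ i, 0 < V (x i) (y i) := fun i =>
      ((hV (x i)).1 _).lt_of_ne fun h => h0 (Finset.prod_eq_zero (Finset.mem_univ i) h.symm)
    have hWi : ∀ i, 0 < W (x i) (y i) := fun i =>
      ((hW (x i)).1 _).lt_of_ne fun h => (hVi i).ne' (hac _ _ h.symm)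
    have hratio : ∏ i, V (x i) (y i) = (∏ i, W (x i) (y i)) *
        Real.exp (∑ i, Real.log (V (x i) (y i) / W (x i) (y i))) := by
      rw [Real.exp_sum, ← Finset.prod_mul_distrib]
      refine Finset.prod_congr rfl fun i _ => ?_
      rw [Real.exp_log (div_pos (hVi i) (hWi i)), mul_div_cancel₀ _ (hWi i).ne']
    -- Either the likelihood ratio is below the threshold (first term), or the exponential tilt
    -- in the second term is at least one.
    rcases le_total (∑ i, Real.log (V (x i) (y i) / W (x i) (y i))) (∑ i, d (x i) + l * a)
      with h | h
    · refine le_add_of_le_of_nonneg ?_ (by positivity)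
      rw [hratio]
      gcongr
    · refine le_add_of_nonneg_of_le (by positivity) (le_mul_of_one_le_right hVn ?_)
      rw [Real.one_le_exp_iff]
      simp only [hf, ← Finset.mul_sum, Finset.sum_sub_distrib]
      nlinarith [mul_le_mul_of_nonneg_left h hθ]
  have hmgf : ∑ y : Fin l → Y, ∏ i, V (x i) (y i) * Real.exp (f (x i) (y i)) ≤
      Real.exp (l * (θ * M) ^ 2) := by
    have hprod := Finset.prod_univ_sum (fun _ : Fin l => (Finset.univ : Finset Y))
      (fun i y => V (x i) y * Real.exp (f (x i) y))
    rw [Fintype.piFinset_univ] at hprod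
    rw [← hprod]
    calc ∏ i, ∑ y, V (x i) y * Real.exp (f (x i) y) ≤ ∏ _i : Fin l, Real.exp ((θ * M) ^ 2) := by
          refine Finset.prod_le_prod (fun i _ => Finset.sum_nonneg fun y _ =>
            mul_nonneg ((hV (x i)).1 y) (Real.exp_pos _).le) fun i _ => ?_
          refine sum_mul_exp_le (hV (x i)) hθM (fun y hy => ?_) ?_
          · rw [hf, abs_mul, abs_of_nonneg hθ]
            exact mul_le_mul_of_nonneg_left (hM _ _ hy) hθ
          · have : ∀ y, V (x i) y * f (x i) y =
                θ * (V (x i) y * Real.log (V (x i) y / W (x i) y) - V (x i) y * d (x i)) :=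
              fun y => by rw [hf]; ring
            simp only [this, ← Finset.mul_sum, Finset.sum_sub_distrib, ← Finset.sum_mul,
              (hV (x i)).2, one_mul]
            simp [hd, relEntropy]
      _ = Real.exp (l * (θ * M) ^ 2) := by
          rw [Finset.prod_const, Finset.card_univ, Fintype.card_fin, ← Real.exp_nat_mul]
  calc channelProb V x A
      ≤ ∑ y ∈ A, ((∏ i, W (x i) (y i)) * Real.exp (∑ i, d (x i) + l * a) +
        (∏ i, V (x i) (y i) * Real.exp (f (x i) (y i))) * Real.exp (-(l * (θ * a)))) :=
        Finset.sum_le_sum fun y _ => hpt y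
    _ = channelProb W x A * Real.exp (∑ i, d (x i) + l * a) +
        (∑ y ∈ A, ∏ i, V (x i) (y i) * Real.exp (f (x i) (y i))) * Real.exp (-(l * (θ * a))) := by
        rw [Finset.sum_add_distrib, ← Finset.sum_mul, ← Finset.sum_mul, channelProb]
    _ ≤ channelProb W x A * Real.exp (∑ i, d (x i) + l * a) +
        Real.exp (l * (θ * M) ^ 2) * Real.exp (-(l * (θ * a))) := by
        gcongr
        exact (Finset.sum_le_univ_sum_of_nonneg fun y => Finset.prod_nonneg fun i _ =>
          mul_nonneg ((hV (x i)).1 _) (Real.exp_pos _).le).trans hmgf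
    _ = _ := by rw [← Real.exp_add, ← mul_neg, ← mul_add, ← sub_eq_add_neg]

lemma sum_empiricalType_mul [DecidableEq X] {l : ℕ} (x : Fin l → X) (f : X → ℝ) :
    ∑ a, empiricalType x a * f a = (∑ i, f (x i)) / l := by
  rw [← Finset.sum_fiberwise (s := Finset.univ) (g := x), Finset.sum_div]
  refine Finset.sum_congr rfl fun a _ => ?_
  rw [Finset.sum_congr rfl fun i hi => by rw [(Finset.mem_filter.1 hi).2], Finset.sum_const,
    empiricalType, nsmul_eq_mul]
  ring

lemma empiricalType_nonneg {X : Type*} [DecidableEq X] {l : ℕ} (x : Fin l → X) (a : X) :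
    0 ≤ empiricalType x a := by
  unfold empiricalType; positivity

lemma channelProb_le_one {X : Type*} {V : X → Y → ℝ} (hV : IsChannel V) {l : ℕ} (x : Fin l → X)
    (A : Finset (Fin l → Y)) : channelProb V x A ≤ 1 := by
  classical
  have hprod := Finset.prod_univ_sum (fun _ : Fin l => (Finset.univ : Finset Y))
    (fun i y => V (x i) y)
  rw [Fintype.piFinset_univ] at hprod
  simp only [(hV _).2, Finset.prod_const_one] at hprod
  rw [hprod]
  exact Finset.sum_le_univ_sum_of_nonneg fun y => Finset.prod_nonneg fun i _ => (hV (x i)).1 _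

/-- The base-two exponential of the penalty, once the conditional divergence is finite. -/
lemma exp2_neg_mul_condDivergence [DecidableEq X] {V W : X → Y → ℝ}
    (hac : ∀ x y, W x y = 0 → V x y = 0) {l : ℕ} (hl : 0 < l) {r : ℝ} (hr : r = l)
    (x : Fin l → X) (e : ℝ) :
    exp2 (-((r : ℝ) : EReal) * (condDivergence V W (empiricalType x) + (e : EReal))) =
      ENNReal.ofReal
        (Real.exp (-(∑ i, relEntropy (V (x i)) (W (x i)) + l * (e * Real.log 2)))) := by
  have hL : 0 < Real.log 2 := Real.log_pos one_lt_two
  have hl' : (0 : ℝ) < l := by exact_mod_cast hl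
  subst hr
  rw [condDivergence_of_ac hac, sum_empiricalType_mul x
    (fun a => relEntropy (V a) (W a) / Real.log 2), ← Finset.sum_div, exp2, ← EReal.coe_neg,
    ← EReal.coe_add, ← EReal.coe_mul, ← EReal.coe_mul, EReal.exp_coe]
  congr 2
  field_simp

/-- At each fixed blocklength a constant penalty suffices: some word of `A` has positive
probability under `W`, hence probability at least `w ^ l`. -/
lemma ofReal_mul_exp2_le_of_small [DecidableEq X] {V W : X → Y → ℝ} (hV : IsChannel V)
    (hW : IsChannel W) {w : ℝ} (hw0 : 0 < w) (hw : ∀ x y, W x y ≠ 0 → w ≤ W x y) {l : ℕ}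
    (hl : 0 < l) {r : ℝ} (hr : r = l) (x : Fin l → X) (A : Finset (Fin l → Y)) {ε : ℝ}
    (hε : 0 < ε) (hA : ε / 2 ≤ channelProb V x A) :
    ENNReal.ofReal (ε / 4) * exp2 (-((r : ℝ) : EReal) *
      (condDivergence V W (empiricalType x) + ((1 - Real.logb 2 w : ℝ) : EReal))) ≤
      ENNReal.ofReal (channelProb W x A) := by
  have hL : 0 < Real.log 2 := Real.log_pos one_lt_two
  have hl' : (0 : ℝ) < l := by exact_mod_cast hl
  subst hr
  have hV1 := channelProb_le_one hV x A
  obtain ⟨y, hyA, hy⟩ : ∃ y ∈ A, 0 < ∏ i, V (x i) (y i) := by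
    by_contra! h
    have : channelProb V x A ≤ 0 := Finset.sum_nonpos h
    linarith
  have hVi : ∀ i, V (x i) (y i) ≠ 0 := fun i h =>
    hy.ne' (Finset.prod_eq_zero (Finset.mem_univ i) h)
  by_cases hac : ∀ i, W (x i) (y i) ≠ 0
  · have hD := condDivergence_nonneg hV hW (empiricalType_nonneg x)
    have h1 : exp2 (-((l : ℝ) : EReal) *
        (condDivergence V W (empiricalType x) + ((1 - Real.logb 2 w : ℝ) : EReal))) ≤
        ENNReal.ofReal (w ^ l) := by
      have h2 : -((l : ℝ) : EReal) *
          (condDivergence V W (empiricalType x) + ((1 - Real.logb 2 w : ℝ) : EReal)) ≤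
          -((l : ℝ) : EReal) * ((1 - Real.logb 2 w : ℝ) : EReal) := by
        rw [neg_mul, neg_mul, EReal.neg_le_neg_iff]
        exact mul_le_mul_of_nonneg_left (le_add_of_nonneg_left hD) (EReal.coe_nonneg.2 hl'.le)
      rw [exp2]
      refine (EReal.exp_monotone (mul_le_mul_of_nonneg_right h2
        (EReal.coe_nonneg.2 hL.le))).trans ?_
      rw [← EReal.coe_neg, ← EReal.coe_mul, ← EReal.coe_mul, EReal.exp_coe]
      refine ENNReal.ofReal_le_ofReal ?_
      rw [← Real.exp_log hw0, ← Real.exp_nat_mul, Real.exp_le_exp, Real.logb, Real.log_exp]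
      field_simp
      nlinarith
    calc _ ≤ ENNReal.ofReal 1 * ENNReal.ofReal (w ^ l) := by
          gcongr
          linarith
      _ ≤ _ := by
          rw [ENNReal.ofReal_one, one_mul]
          refine ENNReal.ofReal_le_ofReal ?_
          calc w ^ l = ∏ _i : Fin l, w := by simp
            _ ≤ ∏ i, W (x i) (y i) :=
              Finset.prod_le_prod (fun _ _ => hw0.le) fun i _ => hw _ _ (hac i)
            _ ≤ channelProb W x A := Finset.single_le_sum
              (f := fun y : Fin l → Y => ∏ i, W (x i) (y i))
              (fun y _ => Finset.prod_nonneg fun i _ => (hW (x i)).1 _) hyA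
  -- If `W` vanishes on a used pair, the conditional divergence is `⊤` and the left side is `0`.
  · push Not at hac
    obtain ⟨i, hi⟩ := hac
    have htype : 0 < empiricalType x (x i) := by
      have : 0 < (Finset.univ.filter fun j => x j = x i).card :=
        Finset.card_pos.2 ⟨i, by simp⟩
      unfold empiricalType; positivity
    have htop : condDivergence V W (empiricalType x) = ⊤ := by
      rw [← top_le_iff]
      calc ⊤ = ((empiricalType x (x i) : ℝ) : EReal) * divergence (V (x i)) (W (x i)) := by
            rw [divergence, if_neg fun h => hVi i (h _ hi), EReal.coe_mul_top_of_pos htype]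
        _ ≤ _ := Finset.single_le_sum (f := fun a =>
            ((empiricalType x a : ℝ) : EReal) * divergence (V a) (W a))
            (fun a _ => mul_nonneg (EReal.coe_nonneg.2 (empiricalType_nonneg x a))
              (divergence_nonneg (hV a) (hW a))) (Finset.mem_univ (x i))
    rw [htop, EReal.top_add_coe, neg_mul, EReal.coe_mul_top_of_pos hl', EReal.neg_top, exp2,
      EReal.bot_mul_coe_of_pos hL, EReal.exp_bot, mul_zero]
    exact zero_le

end Channels

/-! ### Growth rates -/

lemma eventually_mul_rpow_le_rpow (K : ℝ) {a b : ℝ} (hab : a < b) :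
    ∀ᶠ n : ℕ in atTop, K * (n : ℝ) ^ a ≤ (n : ℝ) ^ b := by
  have h := ((tendsto_rpow_atTop (sub_pos.2 hab)).comp
    tendsto_natCast_atTop_atTop).eventually_ge_atTop K
  filter_upwards [h, eventually_ge_atTop 1] with n hn hn1
  have hn0 : (0 : ℝ) < n := by exact_mod_cast hn1
  calc K * (n : ℝ) ^ a ≤ (n : ℝ) ^ (b - a) * (n : ℝ) ^ a := by gcongr; exact hn
    _ = (n : ℝ) ^ b := by rw [← Real.rpow_add hn0]; ring_nf

/-- The exponent `(1 - 3 (t + ζ)) / 4` of the cap on the number of messages. -/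
lemma capExponent_eq (t : ℝ) : (1 - 3 * (t + zeta t)) / 4 = (1 - 3 * t) / 8 := by
  rw [zeta]; ring

lemma eventually_rpow_le_numMessages {t : ℝ} (ht0 : 0 < t) (ht : t < 1 / 3) {S : ℕ → ℕ}
    (hS : (fun n : ℕ => (n : ℝ) ^ t) =o[atTop] (fun n : ℕ => (S n : ℝ))) :
    ∀ᶠ n : ℕ in atTop, (n : ℝ) ^ t ≤ (numMessages t S n : ℝ) := by
  set a := (1 - 3 * t) / 8 with ha
  have ha0 : 0 < a := by rw [ha]; linarith
  have h1 := (isLittleO_rpow_exp_pos_mul_atTop (t / a) (Real.log_pos one_lt_two)).bound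
    (c := 1 / 2) (by norm_num)
  have h2 := ((tendsto_rpow_atTop ha0).comp tendsto_natCast_atTop_atTop).eventually h1
  filter_upwards [h2, hS.bound (c := 1) one_pos, eventually_ge_atTop 1] with n hn hSn hn1
  have hn1' : (1 : ℝ) ≤ n := by exact_mod_cast hn1
  have hnt : 1 ≤ (n : ℝ) ^ t := Real.one_le_rpow hn1' ht0.le
  rw [numMessages, capExponent_eq, ← ha, Nat.cast_min]
  refine le_min ?_ ?_
  · rwa [one_mul, Real.norm_of_nonneg (by positivity), Real.norm_of_nonneg (by positivity)] at hSn
  · simp only [Function.comp_apply] at hn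
    rw [← Real.rpow_mul (by positivity), mul_div_cancel₀ _ ha0.ne',
      Real.norm_of_nonneg (by positivity), Real.norm_of_nonneg (by positivity),
      ← Real.rpow_def_of_pos two_pos] at hn
    have := Nat.sub_one_lt_floor ((2 : ℝ) ^ ((n : ℝ) ^ a))
    linarith

/-- The gap `δ_n` is `O(n ^ (-t))`, and it decays at most like the reciprocal of the cap on the
number of messages. -/
lemma eventually_rateGap_bounds {X Y : Type*} [Fintype X] [Fintype Y] {W : X → Y → ℝ}
    (hC : 0 < capacity W) {t : ℝ} (ht0 : 0 < t) (ht : t < 1 / 3) {T : ℕ} (hT : 2 ≤ T) {S : ℕ → ℕ}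
    (hS : (fun n : ℕ => (n : ℝ) ^ t) =o[atTop] (fun n : ℕ => (S n : ℝ))) :
    ∀ᶠ n : ℕ in atTop, rateGap W t T S n ≤ T * capacity W * (n : ℝ) ^ (-t) ∧
      capacity W / (2 * T) * Real.exp (-(Real.log 2 * (n : ℝ) ^ ((1 - 3 * t) / 8))) ≤
        rateGap W t T S n := by
  have hT' : (2 : ℝ) ≤ T := by exact_mod_cast hT
  filter_upwards [eventually_rpow_le_numMessages ht0 ht hS, eventually_ge_atTop 1,
    eventually_mul_rpow_le_rpow (2 / capacity W) (neg_lt_zero.2 ht0)] with n hN hn1 hR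
  have hn1' : (1 : ℝ) ≤ n := by exact_mod_cast hn1
  have hnt : 0 < (n : ℝ) ^ t := by positivity
  have hnt' : 0 < (n : ℝ) ^ (-t) := by positivity
  rw [Real.rpow_zero, div_mul_eq_mul_div, div_le_one hC] at hR
  have hR1 : rate W t n ≤ capacity W := by rw [rate]; linarith
  have hR2 : capacity W / 2 ≤ rate W t n := by rw [rate]; linarith
  have hR0 : 0 < rate W t n := by linarith
  have hden : 0 < (numMessages t S n : ℝ) + T - 1 := by linarith
  rw [rateGap]
  constructor
  · rw [Real.rpow_neg (by positivity), ← div_eq_mul_inv]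
    exact div_le_div₀ (by positivity) (by nlinarith) hnt (by linarith)
  · have hE : (1 : ℝ) ≤ Real.exp (Real.log 2 * (n : ℝ) ^ ((1 - 3 * t) / 8)) := by
      rw [Real.one_le_exp_iff]; positivity
    have hcap : (numMessages t S n : ℝ) ≤ Real.exp (Real.log 2 * (n : ℝ) ^ ((1 - 3 * t) / 8)) := by
      rw [numMessages, capExponent_eq, ← Real.rpow_def_of_pos two_pos]
      exact (Nat.cast_le.2 (min_le_right _ _)).trans (Nat.floor_le (by positivity))
    rw [Real.exp_neg, ← div_eq_mul_inv, div_div]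
    refine (div_le_div₀ (a := capacity W) (c := capacity W) hC.le le_rfl (by positivity)
      le_rfl).trans ?_
    rw [div_le_div_iff₀ (by positivity) hden]
    have h1 : (numMessages t S n : ℝ) + T - 1 ≤
        T * Real.exp (Real.log 2 * (n : ℝ) ^ ((1 - 3 * t) / 8)) := by nlinarith
    have h2 : capacity W ≤ 2 * (((T : ℝ) - 1) * rate W t n) := by nlinarith
    calc capacity W * ((numMessages t S n : ℝ) + T - 1) ≤ (2 * (((T : ℝ) - 1) * rate W t n)) *
          (T * Real.exp (Real.log 2 * (n : ℝ) ^ ((1 - 3 * t) / 8))) := by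
          gcongr
          nlinarith
      _ = _ := by ring

/-- Since `-log u ≤ 1 / u`, a sequence of order `u / (-log u)` is bounded below by a multiple
of `u ^ 2`. -/
lemma exists_mul_sq_le_of_isTheta {u δ : ℕ → ℝ} (hδ : ∀ n, 0 < δ n)
    (h : δ =Θ[atTop] fun n => u n / (-Real.logb 2 (u n)))
    (hu : ∀ᶠ n in atTop, 0 < u n ∧ u n < 1) : ∃ c > 0, ∀ᶠ n in atTop, c * u n ^ 2 ≤ δ n := by
  have hL : 0 < Real.log 2 := Real.log_pos one_lt_two
  obtain ⟨K, hK, hb⟩ := h.2.exists_pos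
  refine ⟨Real.log 2 / K, by positivity, ?_⟩
  filter_upwards [hb.bound, hu] with n hn hun
  obtain ⟨hu0, hu1⟩ := hun
  rw [Real.norm_of_nonneg (hδ n).le] at hn
  have hlog : 0 < -Real.log (u n) := neg_pos.2 (Real.log_neg hu0 hu1)
  have hlog' : u n * -Real.log (u n) ≤ 1 := by
    have := Real.one_sub_inv_le_log_of_pos hu0
    have h2 : u n * (u n)⁻¹ = 1 := mul_inv_cancel₀ hu0.ne'
    nlinarith
  have key : Real.log 2 * u n ^ 2 ≤ u n / (-Real.logb 2 (u n)) := by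
    rw [Real.logb, ← neg_div, div_div_eq_mul_div, le_div_iff₀ hlog]
    nlinarith [mul_le_mul_of_nonneg_left hlog' (mul_pos hL hu0).le]
  rw [div_mul_eq_mul_div, div_le_iff₀ hK, mul_comm (δ n)]
  exact key.trans ((le_abs_self _).trans hn)

/-- With `a = (1 - 3 t) / 8`, tilt `n ^ (-2 a)` and slack `n ^ (-2 t - a)`, the Chernoff exponent
is of order `n ^ (1 - 2 t - 3 a)` and beats `n ^ a`, because `1 - 2 t - 4 a = (1 - t) / 2`. -/
lemma eventually_chernoff_le {t : ℝ} (ht0 : 0 < t) (ht : t < 1 / 3) {T : ℕ} (hT : 2 ≤ T)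
    (B : ℝ) {c : ℝ} (hc : 0 < c) :
    ∀ᶠ n : ℕ in atTop, Real.exp (((T * n : ℕ) : ℝ) *
        (((n : ℝ) ^ (-2 * ((1 - 3 * t) / 8)) * (B * (n : ℝ) ^ (-t))) ^ 2 -
          (n : ℝ) ^ (-2 * ((1 - 3 * t) / 8)) *
            ((n : ℝ) ^ (-2 * t - (1 - 3 * t) / 8) * Real.log 2))) ≤
      c * Real.exp (-(Real.log 2 * (n : ℝ) ^ ((1 - 3 * t) / 8))) ^ 2 / 4 := by
  have hT' : (2 : ℝ) ≤ T := by exact_mod_cast hT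
  have hL : 0 < Real.log 2 := Real.log_pos one_lt_two
  set a := (1 - 3 * t) / 8 with ha
  set L := Real.log 2 with hLdef
  have ha0 : 0 < a := by rw [ha]; linarith
  filter_upwards [eventually_ge_atTop 1,
    eventually_mul_rpow_le_rpow (4 * B ^ 2 / L)
      (show 1 - 2 * t - 4 * a < 1 - 2 * t - 3 * a by linarith),
    eventually_mul_rpow_le_rpow 4 (show a < 1 - 2 * t - 3 * a by rw [ha]; linarith),
    eventually_mul_rpow_le_rpow (2 * -Real.log (c / 4) / L)
      (show 0 < 1 - 2 * t - 3 * a by rw [ha]; linarith)] with n hn1 h1 h2 h3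
  have hn0 : (0 : ℝ) < n := by exact_mod_cast hn1
  set P := (n : ℝ) ^ (1 - 2 * t - 3 * a) with hP
  have hP0 : 0 < P := by positivity
  have e1 : (n : ℝ) * ((n : ℝ) ^ (-2 * a) * (B * (n : ℝ) ^ (-t))) ^ 2 =
      B ^ 2 * (n : ℝ) ^ (1 - 2 * t - 4 * a) := by
    have : (n : ℝ) ^ (1 - 2 * t - 4 * a) = n * ((n : ℝ) ^ (-2 * a) * (n : ℝ) ^ (-t)) ^ 2 := by
      rw [← Real.rpow_add hn0, ← Real.rpow_mul_natCast hn0.le]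
      nth_rewrite 2 [← Real.rpow_one (n : ℝ)]
      rw [← Real.rpow_add hn0]
      congr 1
      push_cast
      ring
    rw [this]; ring
  have e2 : (n : ℝ) * ((n : ℝ) ^ (-2 * a) * ((n : ℝ) ^ (-2 * t - a) * L)) = P * L := by
    have : P = n * ((n : ℝ) ^ (-2 * a) * (n : ℝ) ^ (-2 * t - a)) := by
      rw [hP, ← Real.rpow_add hn0]
      nth_rewrite 2 [← Real.rpow_one (n : ℝ)]
      rw [← Real.rpow_add hn0]
      congr 1
      ring
    rw [this]; ring
  have hrhs : c * Real.exp (-(L * (n : ℝ) ^ a)) ^ 2 / 4 =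
      Real.exp (Real.log (c / 4) - 2 * (L * (n : ℝ) ^ a)) := by
    rw [sub_eq_add_neg, Real.exp_add, Real.exp_log (by positivity), ← Real.exp_nat_mul]
    push_cast
    ring_nf
  rw [hrhs, Real.exp_le_exp]
  push_cast
  rw [mul_assoc, mul_sub, e1, e2]
  rw [div_mul_eq_mul_div, div_le_iff₀ hL] at h1
  rw [Real.rpow_zero, mul_one, div_le_iff₀ hL] at h3
  nlinarith [mul_le_mul_of_nonneg_left h1 (by linarith : (0 : ℝ) ≤ T), mul_pos hP0 hL,
    mul_le_mul_of_nonneg_left h2 hL.le, mul_le_mul_of_nonneg_right hT' (mul_pos hP0 hL).le]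

end StreamingDMC

/-! ### The lower bound for Haroutunian-optimal channels -/

open StreamingDMC in
theorem lemma5 {X Y : Type*} [Fintype X] [Fintype Y] [DecidableEq X]
    (W : X → Y → ℝ) (hW : IsChannel W) (hsymm : OutputSymmetric W) (hν : 0 < dispersion W)
    (t : ℝ) (ht0 : 0 < t) (ht : t < 1 / 3)
    (T : ℕ) (hT : 2 ≤ T)
    (S : ℕ → ℕ) (hS : (fun n : ℕ => (n : ℝ) ^ t) =o[atTop] (fun n : ℕ => (S n : ℝ)))
    (δ' : ℕ → ℝ) (hδ'pos : ∀ n, 0 < δ' n)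
    (hδ' : δ' =Θ[atTop]
      (fun n : ℕ => rateGap W t T S n / (-Real.logb 2 (rateGap W t T S n))))
    (V : ℕ → X → Y → ℝ) :
    ∃ η : ℕ → ℝ, (∀ n, 0 < η n) ∧
      η =o[atTop] (fun n : ℕ => (n : ℝ) ^ (-2 * t)) ∧
      ∀ n : ℕ, 1 ≤ n →
        IsHaroutunianOptimal W (rate W t n - 2 * rateGap W t T S n) (V n) →
        ∀ (x : Fin (T * n) → X) (A : Finset (Fin (T * n) → Y)),
          δ' n / 2 ≤ channelProb (V n) x A →
          ENNReal.ofReal (δ' n / 4) *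
              exp2 (-(((T : ℝ) * (n : ℝ) : ℝ) : EReal) *
                (condDivergence (V n) W (empiricalType x) + ((η n : ℝ) : EReal)))
            ≤ ENNReal.ofReal (channelProb W x A) := by
  have hL : 0 < Real.log 2 := Real.log_pos one_lt_two
  have hT' : (2 : ℝ) ≤ T := by exact_mod_cast hT
  have hC := (exists_channel_capacity_le hW hsymm hν).1
  obtain ⟨g₀, hg₀, K, hK, hopt⟩ := relEntropy_le_of_isHaroutunianOptimal hW hsymm hν
  obtain ⟨w, hw0, hw1, hw⟩ := exists_pos_le_of_ne_zero hW
  set a := (1 - 3 * t) / 8 with ha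
  have ha0 : 0 < a := by rw [ha]; linarith
  -- `g = C(W) - (R_n - 2 δ_n)` is at most `G * n ^ (-t)`, so the square roots of the likelihood
  -- ratios of `V_n` to `W` differ from one by at most `b * n ^ (-t)`.
  set G : ℝ := 1 + 2 * (T * capacity W) with hG
  have hG0 : 0 < G := by positivity
  set b : ℝ := √(K / w) * G with hb
  have hb0 : 0 ≤ b := by positivity
  have hgap := eventually_rateGap_bounds hC ht0 ht hT hS
  have hgap01 : ∀ᶠ n in atTop, 0 < rateGap W t T S n ∧ rateGap W t T S n < 1 := by
    filter_upwards [hgap, eventually_mul_rpow_le_rpow (2 * (T * capacity W))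
      (neg_lt_zero.2 ht0)] with n ⟨h1, h2⟩ h3
    rw [Real.rpow_zero] at h3
    exact ⟨lt_of_lt_of_le (by positivity) h2, by linarith⟩
  obtain ⟨c, hc, hδc⟩ := exists_mul_sq_le_of_isTheta hδ'pos hδ' hgap01
  have hc' : 0 < c * (capacity W / (2 * T)) ^ 2 := by positivity
  obtain ⟨N, hN⟩ := eventually_atTop.1 <| (((((((eventually_ge_atTop 1).and hgap).and hgap01).and
    hδc).and (eventually_chernoff_le ht0 ht hT (8 * b) hc')).and
    (eventually_mul_rpow_le_rpow (G / g₀) (neg_lt_zero.2 ht0))).and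
    (eventually_mul_rpow_le_rpow (2 * b) (neg_lt_zero.2 ht0))).and
    (eventually_mul_rpow_le_rpow (8 * b) (show -2 * a + -t < 0 by linarith))
  refine ⟨fun n => if N ≤ n then (n : ℝ) ^ (-2 * t - a) else 1 - Real.logb 2 w, fun n => ?_,
    ?_, fun n hn1 hVn x A hA => ?_⟩
  · dsimp only
    split_ifs with h
    · have : (0 : ℝ) < n := by exact_mod_cast (hN n h).1.1.1.1.1.1.1
      positivity
    · have := Real.logb_nonpos one_lt_two hw0.le hw1
      linarith
  · refine isLittleO_iff.2 fun ε hε => ?_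
    filter_upwards [eventually_ge_atTop N,
      eventually_mul_rpow_le_rpow (1 / ε) (show -2 * t - a < -2 * t by linarith)] with n hn h
    rw [if_pos hn, Real.norm_of_nonneg (by positivity), Real.norm_of_nonneg (by positivity)]
    rwa [div_mul_eq_mul_div, one_mul, div_le_iff₀' hε] at h
  · have hl : 0 < T * n := Nat.mul_pos (by omega) hn1
    have hlr : (T : ℝ) * n = ((T * n : ℕ) : ℝ) := by push_cast; rfl
    have hV := hVn.1.1
    dsimp only
    split_ifs with h
    swap
    · exact ofReal_mul_exp2_le_of_small hV hW hw0 hw hl hlr x A (hδ'pos n) hA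
    obtain ⟨⟨⟨⟨⟨⟨⟨-, hgap1, hgap2⟩, hgap0, -⟩, hδn⟩, hch⟩, hg⟩, hs⟩, hθM⟩ := hN n h
    have hn0 : (0 : ℝ) < n := by exact_mod_cast hn1
    rw [Real.rpow_zero] at hg hs hθM
    set g := (n : ℝ) ^ (-t) + 2 * rateGap W t T S n with hgdef
    have hnt : 0 < (n : ℝ) ^ (-t) := by positivity
    have hg0 : 0 ≤ g := by positivity
    have hgG : g ≤ G * (n : ℝ) ^ (-t) := by rw [hgdef, hG]; linarith
    have hgg₀ : g ≤ g₀ := by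
      rw [div_mul_eq_mul_div, div_le_one hg₀] at hg
      exact hgG.trans hg
    obtain ⟨hac, hD⟩ := hopt g hg0 hgg₀ (V n) (by
      rwa [show rate W t n - 2 * rateGap W t T S n = capacity W - g by
        rw [rate, hgdef]; ring] at hVn)
    set s := b * (n : ℝ) ^ (-t) with hsdef
    have hs0 : 0 ≤ s := by positivity
    have hDs : ∀ x, relEntropy (V n x) (W x) ≤ s ^ 2 * w := fun x => by
      refine (hD x).trans ?_
      have : s ^ 2 * w = K * (G * (n : ℝ) ^ (-t)) ^ 2 := by
        rw [hsdef, hb, mul_pow, mul_pow, Real.sq_sqrt (by positivity)]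
        field_simp
      rw [this]
      gcongr
    have hlog : ∀ x y, V n x y ≠ 0 → |Real.log (V n x y / W x y)| ≤ 4 * s := fun x y hy =>
      (abs_log_div_le (hV x) (hW x) (hac x) (hw x) hs0 (by linarith) (hDs x)
        fun h => hy (hac x y h)).2
    have hent : ∀ x, |relEntropy (V n x) (W x)| ≤ 4 * s := fun x => by
      calc |relEntropy (V n x) (W x)|
          ≤ ∑ y, |V n x y * Real.log (V n x y / W x y)| := Finset.abs_sum_le_sum_abs _ _
        _ ≤ ∑ y, V n x y * (4 * s) := by
            refine Finset.sum_le_sum fun y _ => ?_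
            rw [abs_mul, abs_of_nonneg ((hV x).1 y)]
            rcases eq_or_ne (V n x y) 0 with h0 | h0
            · simp [h0]
            · exact mul_le_mul_of_nonneg_left (hlog x y h0) ((hV x).1 y)
        _ = 4 * s := by rw [← Finset.sum_mul, (hV x).2, one_mul]
    have hM : ∀ x y, V n x y ≠ 0 →
        |Real.log (V n x y / W x y) - relEntropy (V n x) (W x)| ≤ 8 * b * (n : ℝ) ^ (-t) :=
      fun x y hy => by
        have := (abs_sub _ _).trans (add_le_add (hlog x y hy) (hent x))
        linarith
    have hcom := channelProb_le hV hW hac (θ := (n : ℝ) ^ (-2 * a))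
      (a := (n : ℝ) ^ (-2 * t - a) * Real.log 2) (by positivity)
      (by
        rw [Real.rpow_add hn0] at hθM
        linarith) hM x A
    have hδ4 : Real.exp (((T * n : ℕ) : ℝ) *
        (((n : ℝ) ^ (-2 * a) * (8 * b * (n : ℝ) ^ (-t))) ^ 2 -
          (n : ℝ) ^ (-2 * a) * ((n : ℝ) ^ (-2 * t - a) * Real.log 2))) ≤ δ' n / 4 := by
      refine hch.trans ?_
      have : (capacity W / (2 * T) * Real.exp (-(Real.log 2 * (n : ℝ) ^ a))) ^ 2 ≤
          rateGap W t T S n ^ 2 := by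
        gcongr
      nlinarith [mul_le_mul_of_nonneg_left this hc.le]
    rw [exp2_neg_mul_condDivergence hac hl hlr x, ← ENNReal.ofReal_mul (by linarith [hδ'pos n]),
      Real.exp_neg, ← div_eq_mul_inv]
    refine ENNReal.ofReal_le_ofReal ?_
    rw [div_le_iff₀ (Real.exp_pos _)]
    linarith
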